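/- **Theorem (ε-optimal AIXI with finite lifetime is $\Sigma^0_1$-hard).** *Setting.* Actions are $\mathcal A=\{\alpha,\beta\}$, percepts are pairs $e=(o,r)\in\mathcal E=\{0,1\}\times\{0,1\}$ of an observation and a reward, histories are $\mathcal H=(\mathcal A\times\mathcal E)^*$, and a policy is a function $\pi:\mathcal H\to\mathcal A$. An *environment* is a lower semicomputable chronological conditional semimeasure: a function $\nu(e_{1:t}\,\|\,a_{1:t})\in[0,1]$ on histories with $\sum_{e}\nu(e_{1:t}e\,\|\,a_{1:t}a)\le\nu(e_{1:t}\,\|\,a_{1:t})$ for every action $a$, such that $\{(h,q)\in\mathcal H\times\mathbb Q: \nu(h)>q\}$ is recursively enumerable. $\mathcal M$ is the class of all environments. An *effective enumeration* of $\mathcal M$ is a uniformly lower semicomputable sequence $(\nu_i)_{i\in\mathbb N}$ of environments, repetitions allowed, in which every element of $\mathcal M$ occurs. A *prefix machine* is a partial recursive function from binary strings to $\mathbb N$ with prefix-free domain; such a machine $U$ is *universal* if for every prefix machine $T$ there is a string $s$ with $U(sp)=T(p)$ for all $p$ (both sides being defined or undefined together). Given an effective enumeration, a universal machine $U$ yields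 the prior $w^U_\nu=\sum_{p:\,\nu_{U(p)}=\nu}2^{-|p|}$ and the universal mixture $\xi_U=\sum_{\nu\in\mathcal M}w^U_\nu\,\nu$. For a discount function $\gamma$ put $\Gamma_t=\sum_{i\ge t}\gamma_i$ and $$V^\pi_\nu(\text{\ae}_{<t})=\frac1{\Gamma_t}\lim_{k\to\infty}\sum_{e_{t:k}}\Big(\sum_{i=t}^k\gamma_i r_i\Big)\frac{\nu(e_{1:k}\,\|\,a_{1:k})}{\nu(e_{<t}\,\|\,a_{<t})}\quad\text{if }\Gamma_t>0,\qquad V^\pi_\nu(\text{\ae}_{<t})=0\quad\text{if }\Gamma_t=0,$$ where for $i\ge t$ the action $a_i$ is the one that $\pi$ takes after the history $\text{\ae}_{<i}$. Let $V^*_\nu(h)=\sup_\pi V^\pi_\nu(h)$, and let $V^*_\nu(ha)$ be the supremum over all $\pi$ of the value at $h$ of the policy that takes $a$ at $h$ and agrees with $\pi$ elsewhere. A policy is *$\varepsilon$-optimal* in $\nu$ if $V^*_\nu(h)-V^\pi_\nu(h)<\varepsilon$ for all $h\in\mathcal H$. Lifetime $m$ means $\gamma_t=1$ for $t\le m$ and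 $\gamma_t=0$ for $t>m$. An *$\varepsilon$-optimal policy for finite-lifetime AIXI* with mixture $\xi$ is a map $m\mapsto\pi_m$ such that, for every $m$, $\pi_m$ is $\varepsilon$-optimal in $\xi$ for lifetime $m$; it is identified with the set of natural-number codes of $\{(m,h,a):\pi_m(h)=a\}$. A set $A\subseteq\mathbb N$ is *$\Sigma^0_1$-hard* if every recursively enumerable set is many-one reducible to $A$. *Claim.* Effective enumerations of $\mathcal M$ and universal prefix machines exist. For every effective enumeration of $\mathcal M$ and every universal prefix machine $U$ there are an environment $\nu\in\mathcal M$ and a universal prefix machine $U'$ such that $$\xi_{U'}=\tfrac12\,\nu+\tfrac18\,\xi_U$$ and, with $\varepsilon=1/9$, every $\varepsilon$-optimal policy for finite-lifetime AIXI with mixture $\xi_{U'}$ is $\Sigma^0_1$-hard. More generally, $\Sigma^0_1$-hardness holds for every map $m\mapsto\pi_m$ that always takes $\varepsilon$-optimal actions, i.e. that satisfies $V^*_{\xi_{U'}}(h)-V^*_{\xi_{U'}}(h\,\pi_m(h))<\varepsilon$ for lifetime $m$, for all $m$ and all $h\in\mathcal H$. -/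

import Mathlib

open scoped BigOperators

noncomputable section

namespace AIXI

/-! ### Computability -/

/-- A set of natural numbers is `Σ⁰₁` iff it is recursively enumerable. -/
def IsSigma01 (A : Set ℕ) : Prop := REPred fun k => k ∈ A

/-- `A` is `Σ⁰₁`-hard: every `Σ⁰₁` set is many-one reducible to `A`. -/
def IsSigma01Hard (A : Set ℕ) : Prop :=
  ∀ B : Set ℕ, IsSigma01 B → ManyOneReducible (fun k => k ∈ B) (fun k => k ∈ A)

/-- `f` is lower semicomputable: `{(x, q) | q < f x}` is recursively enumerable, the rational `q`
being presented as a fraction `z / (d + 1)` with `z : ℤ` and `d : ℕ`. -/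
def LowerSemicomputable {α : Type} [Primcodable α] (f : α → ℝ) : Prop :=
  REPred fun x : α × (ℤ × ℕ) => (x.2.1 : ℝ) / ((x.2.2 : ℝ) + 1) < f x.1

/-! ### Universal prefix Turing machines -/

/-- A prefix (self-delimiting) Turing machine: a partial recursive function on binary programs
with values in `ℕ`, whose halting programs form a prefix-free set. -/
structure IsPrefixMachine (T : List Bool →. ℕ) : Prop where
  partrec : Partrec T
  prefixFree : ∀ p q : List Bool, (T p).Dom → (T q).Dom → p <+: q → p = q

/-- `U` is universal: it simulates every prefix machine `T` once it is fed with a fixed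
program `s` for `T`. -/
structure IsUniversalMachine (U : List Bool →. ℕ) : Prop where
  isPrefixMachine : IsPrefixMachine U
  universal : ∀ T : List Bool →. ℕ, IsPrefixMachine T →
    ∃ s : List Bool, ∀ p : List Bool, U (s ++ p) = T p

/-! ### Interaction of agent and environment -/

/-- The two actions `α = false` and `β = true`. -/
abbrev Action := Bool

/-- A percept `(o, r)` consists of a binary observation and a binary reward. -/
abbrev Percept := Bool × Bool

/-- Finite histories, oldest interaction cycle first. -/
abbrev History := List (Action × Percept)

abbrev Policy := History → Action

/-- The reward of a percept, as a real number. -/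
def reward (e : Percept) : ℝ := if e.2 then 1 else 0

/-- Chronological conditional semimeasures: `ν [(a₁, e₁), …, (aₜ, eₜ)]` is the number
`ν(e₁…eₜ ‖ a₁…aₜ)`, which by chronology does not depend on later actions. -/
structure IsChronologicalSemimeasure (ν : History → ℝ) : Prop where
  mem_Icc : ∀ h, ν h ∈ Set.Icc (0 : ℝ) 1
  sum_le : ∀ (h : History) (a : Action), ∑ e : Percept, ν (h ++ [(a, e)]) ≤ ν h

/-- Lower semicomputable chronological conditional semimeasures. -/
structure IsLSCCCS (ν : History → ℝ) : Prop where
  semimeasure : IsChronologicalSemimeasure ν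
  lsc : LowerSemicomputable ν

/-- The class of all environments. -/
abbrev Env := {ν : History → ℝ // IsLSCCCS ν}

/-! ### The universal mixture -/

/-- An effective enumeration (repetitions allowed) of the class of all environments: the sequence
`E 0, E 1, …` consists exactly of the environments and is uniformly lower semicomputable. -/
structure IsEffectiveEnumeration (E : ℕ → Env) : Prop where
  surjective : Function.Surjective E
  lsc : LowerSemicomputable fun x : ℕ × History => (E x.1).1 x.2

open Classical in
/-- The prior weight that the machine `U` gives to the environment `ν`: the probability that `U`,
fed with uniformly random bits, outputs an index of `ν`, that is
`w_ν = ∑_{p : U(p) is an index of ν} 2^{-|p|}`. -/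
def priorWeight (E : ℕ → Env) (U : List Bool →. ℕ) (ν : Env) : ℝ :=
  ∑' p : List Bool, if ∃ i ∈ U p, E i = ν then (1 / 2 : ℝ) ^ p.length else 0

/-- The universal mixture `ξ = ∑_ν w_ν ν` over all environments `ν`. -/
def mixture (E : ℕ → Env) (U : List Bool →. ℕ) (h : History) : ℝ :=
  ∑' ν : Env, priorWeight E U ν * ν.1 h

/-! ### Value functions -/

/-- `extend π h [eₜ, …, eₘ]` is the history `h` continued by the percepts `eₜ, …, eₘ` and by the
actions that `π` takes. -/
def extend (π : Policy) : History → List Percept → History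
  | h, [] => h
  | h, e :: es => extend π (h ++ [(π h, e)]) es

/-- `Γ_t = ∑_{i ≥ t} γ_i`. -/
def discountNorm (γ : ℕ → ℝ) (t : ℕ) : ℝ := ∑' i : ℕ, γ (t + i)

/-- `∑_{e_{t:m}} R(e_{t:m}) ν(e_{1:m} ∣ e_{<t} ‖ a_{1:m})` for `m = t + n - 1`, where `h` is the
history before time step `t = |h| + 1`. -/
def rewardSum (γ : ℕ → ℝ) (ν : History → ℝ) (π : Policy) (h : History) (n : ℕ) : ℝ :=
  ∑ e : Fin n → Percept, (∑ k : Fin n, γ (h.length + 1 + k) * reward (e k)) *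
    (ν (extend π h (List.ofFn e)) / ν h)

open Classical in
/-- The iterative value `V^π_ν(h)`. -/
def value (γ : ℕ → ℝ) (ν : History → ℝ) (π : Policy) (h : History) : ℝ :=
  if 0 < discountNorm γ (h.length + 1) then
    1 / discountNorm γ (h.length + 1) * Filter.limUnder Filter.atTop (rewardSum γ ν π h)
  else 0

/-- The optimal value `V^*_ν(h) = sup_π V^π_ν(h)`. -/
def optValue (γ : ℕ → ℝ) (ν : History → ℝ) (h : History) : ℝ :=
  ⨆ π : Policy, value γ ν π h

/-- The optimal value `V^*_ν(h a)` if action `a` is taken next: the supremum, over all policies,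
of the value of the policy that is changed to take `a` at the history `h`. -/
def optActionValue (γ : ℕ → ℝ) (ν : History → ℝ) (h : History) (a : Action) : ℝ :=
  ⨆ π : Policy, value γ ν (Function.update π h a) h

/-- `π` is `ε`-optimal in `ν`. -/
def IsEpsOptimal (γ : ℕ → ℝ) (ν : History → ℝ) (ε : ℝ) (π : Policy) : Prop :=
  ∀ h : History, optValue γ ν h - value γ ν π h < ε

/-- At every history `π` takes an action whose optimal value is within `ε` of the optimal value. -/
def TakesEpsOptimalActions (γ : ℕ → ℝ) (ν : History → ℝ) (ε : ℝ) (π : Policy) : Prop :=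
  ∀ h : History, optValue γ ν h - optActionValue γ ν h (π h) < ε

/-- The discount function for finite lifetime `m` (time steps are numbered from `1`). -/
def lifetime (m : ℕ) (t : ℕ) : ℝ := if t ≤ m then 1 else 0

/-- A map from lifetimes `m` to policies, as the set of codes of the triples `(m, h, a)` with
`π m h = a`. -/
def policySet (π : ℕ → Policy) : Set ℕ :=
  {k | ∃ (m : ℕ) (h : History) (a : Action), π m h = a ∧ k = Encodable.encode (m, h, a)}

end AIXI

end

/-! ### Recursively enumerable predicates -/

/-! Hardness comes from an environment, `haltingEnv`, that pays for deciding the halting problem.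
The agent encodes `k` in its actions and then answers. The answer `false` is rewarded with
probability 1/2; the answer `true` is rewarded with certainty if `k` halts and otherwise loses all
mass. Only halting adds mass, so the environment is lower semicomputable, although no computable
policy acts well in it.

The machine `reweight i U` spends the program `1` on an index `i` of this environment and moves `U`
behind the prefix `000`. It is again universal, and its mixture is ½·`haltingEnv` + ⅛·`mixture E U`
(`mixture_reweight`). Lifetime `k + 2` ends exactly with the answer to question `k`, so only that
reward counts. Before normalisation, the two answers differ by ½·½ through `haltingEnv`, and the
rest of the mixture can offset at most ⅛. Dividing by the mass of the question, at most 5/8, leaves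
a gap of at least 1/5 > 1/9 (`not_optimal_of_answerMass_add_half_le`). Hence near-optimal actions
answer correctly, and looking up one action is a many-one reduction of any r.e. set.

The existence claims rest on two repairs of arbitrary codes. For prefix machines, a program is
dropped once a comparable one has been enumerated before it (`prefixRestrict`). For environments,
confirmed lower bounds are closed under superadditivity, and only stages whose root mass is at most
1 are used (`codedEnv`). Neither repair changes an object that was already valid. -/

theorem Nat.rfind_some_dom {f : ℕ → Bool} :
    (Nat.rfind fun n => Part.some (f n)).Dom ↔ ∃ n, f n = true :=
  Nat.rfind_dom'.trans ⟨fun ⟨n, hn, _⟩ => ⟨n, (Part.mem_some_iff.1 hn).symm⟩,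
    fun ⟨n, hn⟩ => ⟨n, by simp [hn], fun _ => trivial⟩⟩

/-- The projection of a computable relation along `ℕ` is recursively enumerable. -/
theorem REPred.exists_nat {α : Type*} [Primcodable α] {R : α → ℕ → Prop}
    (hR : ComputablePred fun x : α × ℕ => R x.1 x.2) : REPred fun a => ∃ n, R a n := by
  obtain ⟨f, hf, hfR⟩ := ComputablePred.computable_iff.1 hR
  have h : Partrec fun a : α => Nat.rfind fun n => Part.some (f (a, n)) :=
    Partrec.rfind hf.partrec
  refine (Partrec.dom_re h).of_eq fun a => ?_
  exact Nat.rfind_some_dom.trans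
    (exists_congr fun n => (Iff.of_eq (congrFun hfR (a, n))).symm)

/-- Every recursively enumerable predicate is the domain of some code. -/
theorem REPred.exists_code {α : Type*} [Primcodable α] {p : α → Prop} (hp : REPred p) :
    ∃ c : Nat.Partrec.Code, ∀ a, (c.eval (Encodable.encode a)).Dom ↔ p a := by
  obtain ⟨c, hc⟩ := Nat.Partrec.Code.exists_code.1 hp
  refine ⟨c, fun a => ?_⟩
  rw [hc]
  simp [Part.assert]

theorem Nat.Partrec.Code.eval_dom_iff {c : Nat.Partrec.Code} {n : ℕ} :
    (c.eval n).Dom ↔ ∃ k, (Nat.Partrec.Code.evaln k c n).isSome := by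
  simp only [Part.dom_iff_mem, Nat.Partrec.Code.evaln_complete, Option.isSome_iff_exists]
  exact exists_comm

theorem Nat.Partrec.Code.evaln_isSome_mono {c : Nat.Partrec.Code} {k l n : ℕ} (hkl : k ≤ l)
    (h : (Nat.Partrec.Code.evaln k c n).isSome) : (Nat.Partrec.Code.evaln l c n).isSome := by
  obtain ⟨x, hx⟩ := Option.isSome_iff_exists.1 h
  exact Option.isSome_iff_exists.2 ⟨x, Nat.Partrec.Code.evaln_mono hkl hx⟩

/-! ### Primitive recursion on the integers -/

theorem Int.encode_natCast (k : ℕ) : Encodable.encode (k : ℤ) = 2 * k := rfl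

theorem Int.encode_negSucc (k : ℕ) : Encodable.encode (Int.negSucc k) = 2 * k + 1 := rfl

theorem Primrec.int_natCast : Primrec fun k : ℕ => (k : ℤ) :=
  Primrec.encode_iff.1 (Primrec.nat_double.of_eq fun k => (Int.encode_natCast k).symm)

theorem Primrec.int_toNat : Primrec Int.toNat := by
  have h : Primrec fun z : ℤ => bif (Encodable.encode z).bodd then 0
      else (Encodable.encode z).div2 :=
    Primrec.cond (Primrec.nat_bodd.comp Primrec.encode) (Primrec.const 0)
      (Primrec.nat_div2.comp Primrec.encode)
  refine h.of_eq fun z => ?_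
  cases z with
  | ofNat k =>
    have := Int.encode_natCast k
    simp only [Int.ofNat_eq_natCast, this]
    simp
  | negSucc k =>
    rw [Int.encode_negSucc]
    simp

theorem PrimrecPred.int_neg : PrimrecPred fun z : ℤ => z < 0 := by
  have h : Primrec fun z : ℤ => (Encodable.encode z).bodd := Primrec.nat_bodd.comp Primrec.encode
  refine Primrec.primrecPred (h.of_eq fun z => ?_)
  cases z with
  | ofNat k =>
    have := Int.encode_natCast k
    simp only [Int.ofNat_eq_natCast, this]
    simp
  | negSucc k =>
    rw [Int.encode_negSucc]
    simp [Int.negSucc_lt_zero]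

namespace AIXI

open Nat.Partrec (Code)

/-! ### A universal prefix machine -/

/-- The step `n` of the enumeration of the domain of `c` produces a string that is comparable
with `p` and differs from it. -/
def conflict (c : Code) (p : List Bool) (n : ℕ) : Prop :=
  (Code.evaln n.unpair.1 c n.unpair.2).isSome ∧
    ∃ q ∈ (Encodable.decode₂ (List Bool) n.unpair.2).toList,
      (p <+: q ∨ q <+: p) ∧ q ≠ p

/-- `p` enters the domain of `c` at step `n`, before every string it is comparable with. -/
def accepted (c : Code) (p : List Bool) (n : ℕ) : Prop :=
  ((Code.evaln n.unpair.1 c n.unpair.2).isSome ∧ n.unpair.2 = Encodable.encode p) ∧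
    ∀ m < n, ¬ conflict c p m

open Classical in
/-- The prefix machine that `c` computes after removing programs that violate prefix-freeness. -/
noncomputable def prefixRestrict (c : Code) (p : List Bool) : Part ℕ :=
  (Nat.rfind fun n => Part.some (decide (accepted c p n))).bind fun _ => c.eval (Encodable.encode p)

theorem primrecRel_isPrefix : PrimrecRel fun p q : List Bool => p <+: q := by
  have h : PrimrecPred fun x : List Bool × List Bool => x.1 = x.2.take x.1.length :=
    Primrec.eq.comp Primrec.fst
      (Primrec.list_take.comp (Primrec.list_length.comp Primrec.fst) Primrec.snd)
  exact h.of_eq fun x => List.prefix_iff_eq_take.symm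

theorem primrecPred_evaln {α : Type*} [Primcodable α] {k : α → ℕ} {c : α → Code} {n : α → ℕ}
    (hk : Primrec k) (hc : Primrec c) (hn : Primrec n) :
    PrimrecPred fun a => ((Code.evaln (k a) (c a) (n a)).isSome : Prop) := by
  have h : Primrec fun a => (Code.evaln (k a) (c a) (n a)).isSome :=
    Primrec.option_isSome.comp (Code.primrec_evaln.comp ((hk.pair hc).pair hn))
  exact Primrec.primrecPred (h.of_eq fun a => by simp)

theorem primrecPred_conflict :
    PrimrecPred fun x : (Code × List Bool) × ℕ => conflict x.1.1 x.1.2 x.2 := by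
  have hu : Primrec fun x : (Code × List Bool) × ℕ => x.2.unpair := Primrec.unpair.comp Primrec.snd
  refine (primrecPred_evaln (Primrec.fst.comp hu) (Primrec.fst.comp Primrec.fst)
    (Primrec.snd.comp hu)).and ?_
  have hR : PrimrecRel fun (q p : List Bool) => (p <+: q ∨ q <+: p) ∧ q ≠ p :=
    (primrecRel_isPrefix.swap.or primrecRel_isPrefix).and Primrec.eq.not
  exact hR.exists_mem_list.comp
    (Primrec.optionToList.comp (Primrec.decode₂.comp (Primrec.snd.comp hu)))
    (Primrec.snd.comp Primrec.fst)

theorem primrecPred_accepted :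
    PrimrecPred fun x : (Code × List Bool) × ℕ => accepted x.1.1 x.1.2 x.2 := by
  have hu : Primrec fun x : (Code × List Bool) × ℕ => x.2.unpair := Primrec.unpair.comp Primrec.snd
  refine ((primrecPred_evaln (Primrec.fst.comp hu) (Primrec.fst.comp Primrec.fst)
    (Primrec.snd.comp hu)).and ?_).and ?_
  · exact Primrec.eq.comp (Primrec.snd.comp hu)
      (Primrec.encode.comp (Primrec.snd.comp Primrec.fst))
  · have hR : PrimrecRel fun (m : ℕ) (y : Code × List Bool) => ¬ conflict y.1 y.2 m :=
      (primrecPred_conflict.comp (Primrec.snd.pair Primrec.fst)).not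
    exact (hR.forall_mem_list.comp (Primrec.list_range.comp Primrec.snd) Primrec.fst).of_eq
      fun x => by simp

open Classical in
theorem partrec_prefixRestrict : Partrec₂ prefixRestrict := by
  have h1 : Computable₂ fun (x : Code × List Bool) (n : ℕ) => decide (accepted x.1 x.2 n) :=
    primrecPred_accepted.computablePred.decide
  have h3 : Partrec fun x : Code × List Bool =>
      Nat.rfind fun n => Part.some (decide (accepted x.1 x.2 n)) :=
    Partrec.rfind h1.partrec₂
  have h4 : Partrec fun x : (Code × List Bool) × ℕ => x.1.1.eval (Encodable.encode x.1.2) :=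
    Code.eval_part.comp (Computable.fst.comp Computable.fst)
      (Computable.encode.comp (Computable.snd.comp Computable.fst))
  exact Partrec.bind h3 h4.to₂

theorem prefixRestrict_dom {c : Code} {p : List Bool} :
    (prefixRestrict c p).Dom ↔ (∃ n, accepted c p n) ∧ (c.eval (Encodable.encode p)).Dom := by
  classical
  have h : (Nat.rfind fun n => Part.some (decide (accepted c p n))).Dom ↔ ∃ n, accepted c p n :=
    Nat.rfind_some_dom.trans (by simp)
  exact ⟨fun ⟨h1, h2⟩ => ⟨h.1 (by convert h1), h2⟩, fun ⟨h1, h2⟩ => ⟨by convert h.2 h1, h2⟩⟩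

/-- Of two distinct comparable programs, the one accepted at the earlier step is a conflict for the
later one. Acceptance at the same step forces equal codes. -/
theorem prefixRestrict_prefixFree {c : Code} {p q : List Bool} (hp : (prefixRestrict c p).Dom)
    (hq : (prefixRestrict c q).Dom) (hpq : p <+: q) : p = q := by
  obtain ⟨⟨m, hm⟩, -⟩ := prefixRestrict_dom.1 hp
  obtain ⟨⟨n, hn⟩, -⟩ := prefixRestrict_dom.1 hq
  by_contra hne
  rcases lt_trichotomy m n with h | h | h
  · refine hn.2 m h ⟨hm.1.1, p, ?_, Or.inr hpq, hne⟩
    simp [hm.1.2]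
  · have := hm.1.2.symm.trans (h ▸ hn.1.2)
    exact hne (Encodable.encode_injective this)
  · refine hm.2 n h ⟨hn.1.1, q, ?_, Or.inl hpq, Ne.symm hne⟩
    simp [hn.1.2]

/-- A conflict would exhibit two distinct comparable programs in the domain of `T`, so every halting
program is accepted. -/
theorem prefixRestrict_eq {c : Code} {T : List Bool →. ℕ} (hT : IsPrefixMachine T)
    (hc : ∀ p, c.eval (Encodable.encode p) = T p) (p : List Bool) : prefixRestrict c p = T p := by
  have key : (T p).Dom → ∃ n, accepted c p n := by
    intro hp
    obtain ⟨k, hk⟩ := Code.eval_dom_iff.1 ((hc p).symm ▸ hp)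
    refine ⟨Nat.pair k (Encodable.encode p), ⟨by simpa using hk, by simp⟩, ?_⟩
    rintro m - ⟨hm, q, hq, hpq, hne⟩
    have henc : Encodable.encode q = m.unpair.2 :=
      Encodable.mem_decode₂.1 (Option.mem_toList.1 hq)
    have hqT : (T q).Dom := by
      rw [← hc q, henc]
      exact Code.eval_dom_iff.2 ⟨_, hm⟩
    rcases hpq with h | h
    · exact hne (hT.prefixFree p q hp hqT h).symm
    · exact hne (hT.prefixFree q p hqT hp h)
  rw [← hc] at key ⊢
  refine Part.ext' ⟨fun h => (prefixRestrict_dom.1 h).2, fun h => prefixRestrict_dom.2 ⟨key h, h⟩⟩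
    fun _ _ => rfl

/-- On input `0ᵏ1q` the universal prefix machine runs the prefix machine of the `k`-th code
on `q`. -/
noncomputable def universalMachine (p : List Bool) : Part ℕ :=
  bif decide (p.idxOf true < p.length) then
    prefixRestrict (Denumerable.ofNat Code (p.idxOf true)) (p.drop (p.idxOf true + 1))
  else Part.none

theorem universalMachine_isUniversal : IsUniversalMachine universalMachine where
  isPrefixMachine :=
    { partrec := by
        have hi : Primrec fun p : List Bool => p.idxOf true :=
          Primrec.list_idxOf.comp (Primrec.const true) Primrec.id
        refine Partrec.cond (Primrec.to_comp ?_) (partrec_prefixRestrict.comp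
          ((Computable.ofNat Code).comp hi.to_comp)
          (Primrec.to_comp (Primrec.list_drop.comp (Primrec.succ.comp hi) Primrec.id)))
          Partrec.none
        exact (Primrec.nat_lt.comp hi Primrec.list_length).decide
      prefixFree := by
        rintro p q hp hq ⟨r, rfl⟩
        unfold universalMachine at hp hq
        by_cases hpl : p.idxOf true < p.length
        -- The header `0ᵏ1` delimits itself: an extension of `p` selects the same code, so
        -- prefix-freeness reduces to that of `prefixRestrict`.
        · have hi : (p ++ r).idxOf true = p.idxOf true :=
            List.idxOf_append_of_mem (List.idxOf_lt_length_iff.1 hpl)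
          have hql : p.idxOf true < (p ++ r).length := by
            rw [List.length_append]; omega
          rw [hi] at hq
          simp only [hpl, hql, decide_true, cond_true] at hp hq
          rw [List.drop_append_of_le_length (by omega)] at hq
          have := prefixRestrict_prefixFree hp hq ⟨r, rfl⟩
          simpa using this
        · simp [hpl] at hp }
  universal := by
    intro T hT
    obtain ⟨c, hc⟩ := Code.exists_code.1 hT.partrec
    refine ⟨List.replicate (Encodable.encode c) false ++ [true], fun p => ?_⟩
    have hi : (List.replicate (Encodable.encode c) false ++ [true] ++ p).idxOf true =
        Encodable.encode c := by
      rw [List.append_assoc, List.idxOf_append_of_notMem (by simp [List.mem_replicate])]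
      simp
    have hd : (List.replicate (Encodable.encode c) false ++ [true] ++ p).drop
        (Encodable.encode c + 1) = p := by
      rw [List.drop_left' (by simp)]
    have hl : Encodable.encode c <
        (List.replicate (Encodable.encode c) false ++ [true] ++ p).length := by
      simp
    rw [universalMachine, hi, hd]
    simp only [hl, decide_true, cond_true, Denumerable.ofNat_encode]
    refine prefixRestrict_eq hT (fun q => ?_) p
    rw [hc]
    simp [Part.map_id']

end AIXI

/-! ### Effective substitution and primitive recursive arithmetic -/

theorem REPred.comp {α β : Type*} [Primcodable α] [Primcodable β] {p : β → Prop} (hp : REPred p)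
    {f : α → β} (hf : Computable f) : REPred fun a => p (f a) :=
  Partrec.comp hp hf

theorem Primrec.nat_factorial : Primrec Nat.factorial := by
  have h : Primrec₂ fun (n m : ℕ) => (n + 1) * m :=
    Primrec.nat_mul.comp (Primrec.succ.comp Primrec.fst) Primrec.snd
  refine (Primrec.nat_rec₁ 1 h).of_eq fun n => ?_
  induction n with
  | zero => rfl
  | succ n ih => rw [Nat.factorial_succ, ← ih]

theorem Primrec.list_foldr_max {α : Type*} [Primcodable α] {f : α → List ℕ} (hf : Primrec f) :
    Primrec fun a => (f a).foldr max 0 :=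
  Primrec.list_foldr hf (Primrec.const 0)
    (Primrec.nat_max.comp (Primrec.fst.comp Primrec.snd) (Primrec.snd.comp Primrec.snd)).to₂

theorem Primrec.list_sum {α : Type*} [Primcodable α] {f : α → List ℕ} (hf : Primrec f) :
    Primrec fun a => (f a).sum :=
  (Primrec.list_foldr hf (Primrec.const 0)
    (Primrec.nat_add.comp (Primrec.fst.comp Primrec.snd) (Primrec.snd.comp Primrec.snd)).to₂).of_eq
    fun a => by simp [List.sum_eq_foldr]

theorem List.foldr_max_le {l : List ℕ} {b : ℕ} : l.foldr max 0 ≤ b ↔ ∀ x ∈ l, x ≤ b := by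
  induction l with
  | nil => simp
  | cons x l ih => simp [ih]

namespace AIXI

open Nat.Partrec (Code)
open scoped Nat

/-! ### An effective enumeration of the environments -/

/-- The lower bound at `h` that the code `c` has confirmed within `s` steps, in units of `1 / s!`. -/
def lowerBound (c : Code) (s : ℕ) (h : History) : ℕ :=
  ((List.range s).map fun n =>
    if (Code.evaln s c (Encodable.encode (h, ((n.unpair.1 : ℤ), n.unpair.2)))).isSome then
      n.unpair.1 * (s ! / (n.unpair.2 + 1)) else 0).foldr max 0

/-- The least superadditive function above `lowerBound c s`, truncated at depth `n`. -/
def envelope (c : Code) (s : ℕ) : ℕ → History → ℕ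
  | 0, _ => 0
  | n + 1, h => max (lowerBound c s h)
      (max (∑ e : Percept, envelope c s n (h ++ [(true, e)]))
        (∑ e : Percept, envelope c s n (h ++ [(false, e)])))

theorem lowerBound_le_iff {c : Code} {s : ℕ} {h : History} {b : ℕ} :
    lowerBound c s h ≤ b ↔ ∀ n < s,
      (Code.evaln s c (Encodable.encode (h, ((n.unpair.1 : ℤ), n.unpair.2)))).isSome →
        n.unpair.1 * (s ! / (n.unpair.2 + 1)) ≤ b := by
  rw [lowerBound, List.foldr_max_le]
  simp only [List.mem_map, List.mem_range, forall_exists_index, and_imp,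
    forall_apply_eq_imp_iff₂]
  refine forall₂_congr fun n _ => ?_
  split_ifs with hn
  · exact ⟨fun hb _ => hb, fun hb => hb hn⟩
  · exact ⟨fun _ hn' => absurd hn' hn, fun _ => Nat.zero_le _⟩

theorem primrec_lowerBound :
    Primrec fun x : (Code × ℕ) × History => lowerBound x.1.1 x.1.2 x.2 := by
  refine Primrec.list_foldr_max (Primrec.list_map
    (Primrec.list_range.comp (Primrec.snd.comp Primrec.fst)) (Primrec₂.mk ?_))
  have hc : Primrec fun y : ((Code × ℕ) × History) × ℕ => y.1.1.1 :=
    Primrec.fst.comp (Primrec.fst.comp Primrec.fst)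
  have hs : Primrec fun y : ((Code × ℕ) × History) × ℕ => y.1.1.2 :=
    Primrec.snd.comp (Primrec.fst.comp Primrec.fst)
  have hh : Primrec fun y : ((Code × ℕ) × History) × ℕ => y.1.2 := Primrec.snd.comp Primrec.fst
  have hu : Primrec fun y : ((Code × ℕ) × History) × ℕ => y.2.unpair :=
    Primrec.unpair.comp Primrec.snd
  have hk := Primrec.fst.comp hu
  have hd := Primrec.snd.comp hu
  refine Primrec.ite (primrecPred_evaln hs hc (Primrec.encode.comp
    (hh.pair ((Primrec.int_natCast.comp hk).pair hd)))) ?_ (Primrec.const 0)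
  exact Primrec.nat_mul.comp hk (Primrec.nat_div.comp (Primrec.nat_factorial.comp hs)
    (Primrec.succ.comp hd))

/-- All interaction cycles, those with the action `true` first. -/
def cycles : List (Action × Percept) :=
  [(true, (true, true)), (true, (true, false)), (true, (false, true)), (true, (false, false)),
    (false, (true, true)), (false, (true, false)), (false, (false, true)), (false, (false, false))]

theorem primrec_envelope :
    Primrec fun x : (Code × ℕ) × (ℕ × History) => envelope x.1.1 x.1.2 x.2.1 x.2.2 := by
  have hcs : Primrec fun x : (Code × ℕ) × (ℕ × History) => x.1 := Primrec.fst
  have hn : Primrec fun x : (Code × ℕ) × (ℕ × History) => x.2.1 := Primrec.fst.comp Primrec.snd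
  have hh : Primrec fun x : (Code × ℕ) × (ℕ × History) => x.2.2 := Primrec.snd.comp Primrec.snd
  -- The history grows along the recursion, so this is well-founded recursion on the depth with
  -- eight recursive calls. `cycles` lists action `true` first, so `take 4` and `drop 4` separate
  -- the two actions.
  refine Primrec.nat_omega_rec' (m := fun x => x.2.1)
    (l := fun x => if x.2.1 = 0 then [] else
      cycles.map fun b => (x.1, (x.2.1 - 1, x.2.2 ++ [b])))
    (g := fun x L => some (if x.2.1 = 0 then 0 else
      max (lowerBound x.1.1 x.1.2 x.2.2) (max (L.take 4).sum (L.drop 4).sum)))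
    _ hn ?_ ?_ ?_ ?_
  · refine Primrec.ite (Primrec.eq.comp hn (Primrec.const 0)) (Primrec.const [])
      (Primrec.list_map (Primrec.const cycles) (Primrec₂.mk ?_))
    exact (hcs.comp Primrec.fst).pair ((Primrec.pred.comp (hn.comp Primrec.fst)).pair
      (Primrec.list_concat.comp (hh.comp Primrec.fst) Primrec.snd))
  · refine Primrec.option_some.comp (Primrec.ite (Primrec.eq.comp (hn.comp Primrec.fst)
      (Primrec.const 0)) (Primrec.const 0) (Primrec.nat_max.comp
        (primrec_lowerBound.comp ((hcs.comp Primrec.fst).pair (hh.comp Primrec.fst)))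
        (Primrec.nat_max.comp (Primrec.list_sum ?_) (Primrec.list_sum ?_))))
    · exact Primrec.list_take.comp (Primrec.const 4) Primrec.snd
    · exact Primrec.list_drop.comp (Primrec.const 4) Primrec.snd
  · rintro ⟨cs, n, h⟩ b' hb'
    cases n with
    | zero => simp at hb'
    | succ n =>
      simp only [Nat.add_eq_zero_iff, one_ne_zero, and_false, if_false, List.mem_map] at hb'
      obtain ⟨b, -, rfl⟩ := hb'
      simp
  · rintro ⟨cs, n, h⟩
    cases n with
    | zero => simp [envelope]
    | succ n =>
      simp [envelope, cycles, Fintype.sum_prod_type, add_assoc]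

theorem sum_envelope_le (c : Code) (s n : ℕ) (h : History) (a : Action) :
    ∑ e : Percept, envelope c s n (h ++ [(a, e)]) ≤ envelope c s (n + 1) h := by
  rw [envelope]
  cases a
  · exact le_max_of_le_right (le_max_right _ _)
  · exact le_max_of_le_right (le_max_left _ _)

theorem envelope_le_envelope_nil (c : Code) (s : ℕ) (h : History) :
    envelope c s (s - h.length) h ≤ envelope c s s [] := by
  induction h using List.reverseRecOn with
  | nil => simp
  | append_singleton h b ih =>
    refine le_trans ?_ ih
    rcases Nat.lt_or_ge h.length s with hs | hs
    · have hsub : s - h.length = (s - (h ++ [b]).length) + 1 := by simp; omega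
      rw [hsub]
      refine le_trans ?_ (sum_envelope_le c s _ h b.1)
      exact Finset.single_le_sum (f := fun e => envelope c s _ (h ++ [(b.1, e)]))
        (fun _ _ => Nat.zero_le _) (Finset.mem_univ b.2)
    · have hsub : s - (h ++ [b]).length = 0 := by simp; omega
      rw [hsub, envelope]
      exact Nat.zero_le _

/-- Stages `s` and `t` count in units `1 / s!` and `1 / t!`, so monotonicity is stated
cross-multiplied. A fraction inspected at stage `s` has index below `s`, hence a denominator
dividing both factorials, and rescaling is exact. -/
theorem lowerBound_mul_factorial_le {c : Code} {s t : ℕ} (hst : s ≤ t) (h : History) :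
    lowerBound c s h * t ! ≤ lowerBound c t h * s ! := by
  have key : lowerBound c s h ≤ lowerBound c t h * s ! / t ! := by
    rw [lowerBound_le_iff]
    intro n hn he
    rw [Nat.le_div_iff_mul_le (Nat.factorial_pos t)]
    have hd : n.unpair.2 + 1 ≤ s := (Nat.unpair_right_le n).trans_lt hn
    have hs : n.unpair.2 + 1 ∣ s ! := Nat.dvd_factorial (Nat.succ_pos _) hd
    have ht : n.unpair.2 + 1 ∣ t ! := Nat.dvd_factorial (Nat.succ_pos _) (hd.trans hst)
    have heq : n.unpair.1 * (s ! / (n.unpair.2 + 1)) * t ! =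
        n.unpair.1 * (t ! / (n.unpair.2 + 1)) * s ! := by
      obtain ⟨x, hx⟩ := hs
      obtain ⟨y, hy⟩ := ht
      rw [hx, hy, Nat.mul_div_cancel_left _ (Nat.succ_pos _),
        Nat.mul_div_cancel_left _ (Nat.succ_pos _)]
      ring
    rw [heq]
    exact Nat.mul_le_mul_right _ (lowerBound_le_iff.1 le_rfl n (hn.trans_le hst)
      (Code.evaln_isSome_mono hst he))
  calc lowerBound c s h * t ! ≤ lowerBound c t h * s ! / t ! * t ! := Nat.mul_le_mul_right _ key
    _ ≤ _ := Nat.div_mul_le_self _ _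

theorem envelope_mul_factorial_le {c : Code} {s t : ℕ} (hst : s ≤ t) :
    ∀ {n m : ℕ}, n ≤ m → ∀ h, envelope c s n h * t ! ≤ envelope c t m h * s ! := by
  intro n
  induction n with
  | zero => simp [envelope]
  | succ n ih =>
    intro m hm h
    obtain ⟨m, rfl⟩ : ∃ k, m = k + 1 := ⟨m - 1, by omega⟩
    have hnm : n ≤ m := by omega
    have hsum : ∀ a, (∑ e : Percept, envelope c s n (h ++ [(a, e)])) * t ! ≤
        (∑ e : Percept, envelope c t m (h ++ [(a, e)])) * s ! := by
      intro a
      rw [Finset.sum_mul, Finset.sum_mul]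
      exact Finset.sum_le_sum fun e _ => ih hnm _
    simp only [envelope, max_mul]
    exact max_le_max (lowerBound_mul_factorial_le hst h) (max_le_max (hsum _) (hsum _))

/-- A semimeasure above the confirmed bounds is itself superadditive, so it dominates the least
superadditive majorant. This makes every stage feasible when `c` enumerates a genuine environment.
-/
theorem envelope_le_mul {c : Code} {s : ℕ} {ρ : History → ℝ}
    (hρ : IsChronologicalSemimeasure ρ)
    (hc : ∀ (h : History) (k d : ℕ),
      (Code.evaln s c (Encodable.encode (h, ((k : ℤ), d)))).isSome →
        (k : ℝ) / ((d : ℝ) + 1) ≤ ρ h) :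
    ∀ (n : ℕ) (h : History), (envelope c s n h : ℝ) ≤ s ! * ρ h := by
  intro n
  induction n with
  | zero => intro h; simpa [envelope] using mul_nonneg (Nat.cast_nonneg _) (hρ.mem_Icc h).1
  | succ n ih =>
    intro h
    have hsum : ∀ a, ((∑ e : Percept, envelope c s n (h ++ [(a, e)]) : ℕ) : ℝ) ≤ s ! * ρ h := by
      intro a
      push_cast
      calc _ ≤ ∑ e : Percept, s ! * ρ (h ++ [(a, e)]) := Finset.sum_le_sum fun e _ => ih _
        _ = s ! * ∑ e : Percept, ρ (h ++ [(a, e)]) := (Finset.mul_sum _ _ _).symm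
        _ ≤ _ := mul_le_mul_of_nonneg_left (hρ.sum_le h a) (Nat.cast_nonneg _)
    have hlow : (lowerBound c s h : ℝ) ≤ s ! * ρ h := by
      rw [← Nat.le_floor_iff (mul_nonneg (Nat.cast_nonneg _) (hρ.mem_Icc h).1),
        lowerBound_le_iff]
      intro k hk he
      rw [Nat.le_floor_iff (mul_nonneg (Nat.cast_nonneg _) (hρ.mem_Icc h).1)]
      have hd : k.unpair.2 + 1 ∣ s ! :=
        Nat.dvd_factorial (Nat.succ_pos _) ((Nat.unpair_right_le k).trans_lt hk)
      rw [Nat.cast_mul, Nat.cast_div hd (by positivity)]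
      have := mul_le_mul_of_nonneg_left (hc h _ _ he) (Nat.cast_nonneg (α := ℝ) (s !))
      push_cast
      calc _ = (s ! : ℝ) * ((k.unpair.1 : ℝ) / (k.unpair.2 + 1)) := by ring
        _ ≤ _ := this
    rw [envelope, Nat.cast_max, Nat.cast_max]
    exact max_le hlow (max_le (hsum _) (hsum _))

/-- The bounds that `c` confirms within `s` steps lie below some chronological semimeasure. -/
def Feasible (c : Code) (s : ℕ) : Prop := envelope c s s [] ≤ s !

theorem feasible_zero (c : Code) : Feasible c 0 := by simp [Feasible, envelope]

instance (c : Code) : Nonempty {s // Feasible c s} := ⟨⟨0, feasible_zero c⟩⟩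

/-- The `s`-th lower approximation of the environment with code `c`. -/
noncomputable def approx (c : Code) (s : ℕ) (h : History) : ℝ :=
  (envelope c s (s - h.length) h : ℝ) / s !

/-- The environment with code `c`. -/
noncomputable def codedEnv (c : Code) (h : History) : ℝ :=
  ⨆ s : {s // Feasible c s}, approx c s h

theorem approx_nonneg (c : Code) (s : ℕ) (h : History) : 0 ≤ approx c s h := by
  unfold approx; positivity

theorem approx_le_one {c : Code} {s : ℕ} (hs : Feasible c s) (h : History) :
    approx c s h ≤ 1 := by
  rw [approx, div_le_one (by positivity)]
  exact_mod_cast (envelope_le_envelope_nil c s h).trans hs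

theorem approx_mono (c : Code) (h : History) : Monotone fun s => approx c s h := by
  intro s t hst
  have := envelope_mul_factorial_le (c := c) hst (Nat.sub_le_sub_right hst h.length) h
  simp only [approx]
  rw [div_le_div_iff₀ (by positivity) (by positivity)]
  exact_mod_cast this

/-- The truncation depth `s - h.length` drops by one from a history to its children, matching one
unfolding of `envelope`; beyond length `s` everything vanishes. -/
theorem sum_approx_le (c : Code) (s : ℕ) (h : History) (a : Action) :
    ∑ e : Percept, approx c s (h ++ [(a, e)]) ≤ approx c s h := by
  simp only [approx, ← Finset.sum_div]
  refine div_le_div_of_nonneg_right ?_ (by positivity)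
  rcases Nat.lt_or_ge h.length s with hs | hs
  · have hsub : s - h.length = (s - (h.length + 1)) + 1 := by omega
    rw [hsub]
    simp only [List.length_append, List.length_singleton]
    exact_mod_cast sum_envelope_le c s _ h a
  · have hsub : s - (h.length + 1) = 0 := by omega
    simp [hsub, envelope]

theorem bddAbove_approx (c : Code) (h : History) :
    BddAbove (Set.range fun s : {s // Feasible c s} => approx c s h) :=
  ⟨1, by rintro _ ⟨s, rfl⟩; exact approx_le_one s.2 h⟩

theorem tendsto_approx (c : Code) (h : History) :
    Filter.Tendsto (fun s : {s // Feasible c s} => approx c s h) Filter.atTop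
      (nhds (codedEnv c h)) :=
  tendsto_atTop_ciSup (fun _ _ hst => approx_mono c h hst) (bddAbove_approx c h)

theorem codedEnv_isChronologicalSemimeasure (c : Code) :
    IsChronologicalSemimeasure (codedEnv c) where
  mem_Icc h := ⟨Real.iSup_nonneg fun s => approx_nonneg c s h,
    ciSup_le fun s => approx_le_one s.2 h⟩
  sum_le h a := le_of_tendsto_of_tendsto' (tendsto_finsetSum _ fun _ _ => tendsto_approx c _)
    (tendsto_approx c h) fun s => sum_approx_le c s h a

/-- Clearing denominators leaves a primitive recursive condition on the stage, which is what uniform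
lower semicomputability needs. -/
theorem lt_codedEnv_iff {c : Code} {h : History} {z : ℤ} {d : ℕ} :
    (z : ℝ) / ((d : ℝ) + 1) < codedEnv c h ↔ ∃ s, envelope c s s [] ≤ s ! ∧
      (z < 0 ∨ z.toNat * s ! < envelope c s (s - h.length) h * (d + 1)) := by
  rw [codedEnv, lt_ciSup_iff (bddAbove_approx c h)]
  have key : ∀ s, (z : ℝ) / ((d : ℝ) + 1) < approx c s h ↔
      (z < 0 ∨ z.toNat * s ! < envelope c s (s - h.length) h * (d + 1)) := by
    intro s
    rcases lt_or_ge z 0 with hz | hz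
    · simp only [hz, true_or, iff_true]
      refine lt_of_lt_of_le (div_neg_of_neg_of_pos (by exact_mod_cast hz) (by positivity))
        (approx_nonneg c s h)
    · obtain ⟨k, rfl⟩ := Int.eq_ofNat_of_zero_le hz
      simp only [approx, hz.not_gt, false_or, Int.toNat_natCast, Int.cast_natCast]
      rw [div_lt_div_iff₀ (by positivity) (by positivity)]
      exact_mod_cast Iff.rfl
  constructor
  · rintro ⟨⟨s, hs⟩, h⟩
    exact ⟨s, hs, (key s).1 h⟩
  · rintro ⟨s, hs, h⟩
    exact ⟨⟨s, hs⟩, (key s).2 h⟩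

theorem codedEnv_lowerSemicomputable :
    LowerSemicomputable fun x : ℕ × History => codedEnv (Denumerable.ofNat Code x.1) x.2 := by
  have hR : PrimrecPred fun y : ((ℕ × History) × (ℤ × ℕ)) × ℕ =>
      envelope (Denumerable.ofNat Code y.1.1.1) y.2 y.2 [] ≤ y.2 ! ∧
      (y.1.2.1 < 0 ∨ y.1.2.1.toNat * y.2 ! <
        envelope (Denumerable.ofNat Code y.1.1.1) y.2 (y.2 - y.1.1.2.length) y.1.1.2 *
          (y.1.2.2 + 1)) := by
    have hi : Primrec fun y : ((ℕ × History) × (ℤ × ℕ)) × ℕ => Denumerable.ofNat Code y.1.1.1 :=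
      (Primrec.ofNat Code).comp (Primrec.fst.comp (Primrec.fst.comp Primrec.fst))
    have hh : Primrec fun y : ((ℕ × History) × (ℤ × ℕ)) × ℕ => y.1.1.2 :=
      Primrec.snd.comp (Primrec.fst.comp Primrec.fst)
    have hz : Primrec fun y : ((ℕ × History) × (ℤ × ℕ)) × ℕ => y.1.2.1 :=
      Primrec.fst.comp (Primrec.snd.comp Primrec.fst)
    have hd : Primrec fun y : ((ℕ × History) × (ℤ × ℕ)) × ℕ => y.1.2.2 :=
      Primrec.snd.comp (Primrec.snd.comp Primrec.fst)
    have hs : Primrec fun y : ((ℕ × History) × (ℤ × ℕ)) × ℕ => y.2 := Primrec.snd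
    have hf := Primrec.nat_factorial.comp hs
    refine (Primrec.nat_le.comp (primrec_envelope.comp ((hi.pair hs).pair
      (hs.pair (Primrec.const [])))) hf).and ((PrimrecPred.int_neg.comp hz).or ?_)
    refine Primrec.nat_lt.comp (Primrec.nat_mul.comp (Primrec.int_toNat.comp hz) hf)
      (Primrec.nat_mul.comp (primrec_envelope.comp ((hi.pair hs).pair
        ((Primrec.nat_sub.comp hs (Primrec.list_length.comp hh)).pair hh)))
        (Primrec.succ.comp hd))
  exact (REPred.exists_nat hR.computablePred).of_eq fun x => lt_codedEnv_iff.symm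

theorem codedEnv_isLSCCCS (c : Code) : IsLSCCCS (codedEnv c) where
  semimeasure := codedEnv_isChronologicalSemimeasure c
  lsc := by
    have h : Computable fun x : History × (ℤ × ℕ) => ((Encodable.encode c, x.1), x.2) :=
      ((Computable.const _).pair Computable.fst).pair Computable.snd
    exact (codedEnv_lowerSemicomputable.comp h).of_eq fun x => by simp

theorem exists_codedEnv_eq (ρ : Env) : ∃ c, codedEnv c = ρ.1 := by
  obtain ⟨c, hc⟩ := REPred.exists_code ρ.2.lsc
  have hle : ∀ s n h, (envelope c s n h : ℝ) ≤ s ! * ρ.1 h := by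
    intro s
    refine envelope_le_mul ρ.2.semimeasure fun h k d he => ?_
    have hlt : ((k : ℤ) : ℝ) / ((d : ℝ) + 1) < ρ.1 h :=
      (hc (h, ((k : ℤ), d))).1 (Code.eval_dom_iff.2 ⟨s, he⟩)
    rw [Int.cast_natCast] at hlt
    exact hlt.le
  refine ⟨c, funext fun h => le_antisymm (ciSup_le fun s => ?_) ?_⟩
  · rw [approx, div_le_iff₀' (by positivity)]
    exact hle _ _ _
  · by_contra! hlt
    obtain ⟨q, hq1, hq2⟩ := exists_rat_btwn hlt
    have hq0 : 0 ≤ q := by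
      exact_mod_cast ((codedEnv_isChronologicalSemimeasure c).mem_Icc h).1.trans hq1.le
    obtain ⟨k, d, hkd⟩ : ∃ k d : ℕ, (q : ℝ) = (k : ℝ) / ((d : ℝ) + 1) := by
      refine ⟨q.num.toNat, q.den - 1, ?_⟩
      have h1 : ((q.num.toNat : ℤ) : ℝ) = q.num := by
        rw [Int.toNat_of_nonneg (Rat.num_nonneg.2 hq0)]
      have h2 : ((q.den - 1 : ℕ) : ℝ) + 1 = q.den := by
        exact_mod_cast Nat.sub_add_cancel q.den_pos
      rw [h2, Rat.cast_def, ← h1, Int.cast_natCast]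
    have hdom : (c.eval (Encodable.encode (h, ((k : ℤ), d)))).Dom :=
      (hc (h, ((k : ℤ), d))).2 (by
        change ((k : ℤ) : ℝ) / ((d : ℝ) + 1) < ρ.1 h
        rwa [Int.cast_natCast, ← hkd])
    obtain ⟨t, ht⟩ := Code.eval_dom_iff.1 hdom
    -- The stage must be late enough for `c` to have halted, for the fraction `k / (d + 1)` to be
    -- inspected with `d + 1 ∣ s!`, and for the depth left at `h` to be positive.
    set s := max t (max (Nat.pair k d + 1) (h.length + 1)) with hs
    have hts : t ≤ s := le_max_left _ _
    have hks : Nat.pair k d + 1 ≤ s := (le_max_left _ _).trans (le_max_right _ _)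
    have hhs : h.length + 1 ≤ s := (le_max_right _ _).trans (le_max_right _ _)
    have hfeas : Feasible c s := by
      have h1 := (hle s s []).trans
        (mul_le_of_le_one_right (Nat.cast_nonneg _) (ρ.2.semimeasure.mem_Icc []).2)
      exact_mod_cast h1
    have hlow := lowerBound_le_iff.1 (le_refl (lowerBound c s h)) (Nat.pair k d) hks
      (by simpa using Code.evaln_isSome_mono hts ht)
    simp only [Nat.unpair_pair] at hlow
    have henv : lowerBound c s h ≤ envelope c s (s - h.length) h := by
      have hsub : s - h.length = (s - (h.length + 1)) + 1 := by omega
      rw [hsub, envelope]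
      exact le_max_left _ _
    have hd : d + 1 ∣ s ! :=
      Nat.dvd_factorial (Nat.succ_pos _) ((Nat.right_le_pair k d).trans_lt hks)
    have hval : (q : ℝ) ≤ approx c s h := by
      rw [approx, le_div_iff₀ (by positivity), hkd]
      have h2 : ((k * (s ! / (d + 1)) : ℕ) : ℝ) ≤ (envelope c s (s - h.length) h : ℝ) := by
        exact_mod_cast hlow.trans henv
      rw [Nat.cast_mul, Nat.cast_div hd (by positivity)] at h2
      push_cast at h2
      calc _ = (k : ℝ) * (s ! / (d + 1)) := by ring
        _ ≤ _ := h2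
    exact absurd (hq1.trans_le hval) (le_ciSup (bddAbove_approx c h) ⟨s, hfeas⟩).not_gt

theorem exists_isEffectiveEnumeration : ∃ E : ℕ → Env, IsEffectiveEnumeration E := by
  refine ⟨fun i => ⟨codedEnv (Denumerable.ofNat Code i), codedEnv_isLSCCCS _⟩, fun ρ => ?_,
    codedEnv_lowerSemicomputable⟩
  obtain ⟨c, hc⟩ := exists_codedEnv_eq ρ
  exact ⟨Encodable.encode c, Subtype.ext (by simpa using hc)⟩

end AIXI

/-! ### Kraft's inequality for prefix codes -/

/-- The first words of two factorisations are prefixes of the same string, hence comparable, hence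
equal; cancel and recurse. -/
theorem InformationTheory.uniquelyDecodable_of_prefixFree {α : Type*} {S : Set (List α)}
    (hnil : [] ∉ S) (hS : ∀ p ∈ S, ∀ q ∈ S, p <+: q → p = q) :
    InformationTheory.UniquelyDecodable S := by
  intro L₁
  induction L₁ with
  | nil =>
    intro L₂ _ h₂ h
    cases L₂ with
    | nil => rfl
    | cons q L₂ =>
      have hq : q = [] := by simp at h; exact h.1
      exact absurd (hq ▸ h₂ q (by simp)) hnil
  | cons p L₁ ih =>
    intro L₂ h₁ h₂ h
    cases L₂ with
    | nil =>
      have hp : p = [] := by simp at h; exact h.1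
      exact absurd (hp ▸ h₁ p (by simp)) hnil
    | cons q L₂ =>
      have hp := h₁ p (by simp)
      have hq := h₂ q (by simp)
      simp only [List.flatten_cons] at h
      have hpq : p = q := by
        rcases List.prefix_or_prefix_of_prefix (List.prefix_append p L₁.flatten)
          (h ▸ List.prefix_append q L₂.flatten) with hpre | hpre
        · exact hS p hp q hq hpre
        · exact (hS q hq p hp hpre).symm
      subst hpq
      rw [ih L₂ (fun w hw => h₁ w (by simp [hw])) (fun w hw => h₂ w (by simp [hw]))
        (List.append_cancel_left h)]

theorem InformationTheory.sum_pow_length_le_one_of_prefixFree {S : Finset (List Bool)}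
    (hS : ∀ p ∈ S, ∀ q ∈ S, p <+: q → p = q) : ∑ p ∈ S, (1 / 2 : ℝ) ^ p.length ≤ 1 := by
  by_cases hnil : [] ∈ S
  · have hsub : S ⊆ {[]} := fun q hq => by
      simpa using (hS [] hnil q hq (List.nil_prefix)).symm
    exact (Finset.sum_le_sum_of_subset_of_nonneg hsub fun _ _ _ => by positivity).trans (by simp)
  · have h := InformationTheory.kraft_mcmillan_inequality (S := S)
      (InformationTheory.uniquelyDecodable_of_prefixFree hnil hS)
    simpa using h

namespace AIXI

/-! ### The universal mixture -/

open Classical in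
theorem IsPrefixMachine.sum_le_one {U : List Bool →. ℕ} (hU : IsPrefixMachine U)
    (S : Finset (List Bool)) :
    ∑ p ∈ S, (if (U p).Dom then (1 / 2 : ℝ) ^ p.length else 0) ≤ 1 := by
  rw [← Finset.sum_filter]
  refine InformationTheory.sum_pow_length_le_one_of_prefixFree fun p hp q hq => ?_
  exact hU.prefixFree p q (Finset.mem_filter.1 hp).2 (Finset.mem_filter.1 hq).2

open Classical in
theorem IsPrefixMachine.summable {U : List Bool →. ℕ} (hU : IsPrefixMachine U) :
    Summable fun p => if (U p).Dom then (1 / 2 : ℝ) ^ p.length else 0 :=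
  summable_of_sum_le (fun p => by dsimp only; split_ifs <;> positivity) hU.sum_le_one

variable {E : ℕ → Env} {U : List Bool →. ℕ}

open Classical in
-- A program has at most one output, so it contributes to at most one environment. Total prior
-- weight is therefore bounded by the halting probability, and Kraft's inequality applies.
theorem ite_mem_le_ite_dom (E : ℕ → Env) (U : List Bool →. ℕ) (S : Finset Env) (p : List Bool) :
    ∑ ν ∈ S, (if ∃ i ∈ U p, E i = ν then (1 / 2 : ℝ) ^ p.length else 0) ≤
      if (U p).Dom then (1 / 2 : ℝ) ^ p.length else 0 := by
  split_ifs with hp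
  · obtain ⟨i, hi⟩ := Part.dom_iff_mem.1 hp
    have h : ∀ ν, (∃ j ∈ U p, E j = ν) ↔ E i = ν := fun ν =>
      ⟨fun ⟨j, hj, hν⟩ => Part.mem_unique hi hj ▸ hν, fun hν => ⟨i, hi, hν⟩⟩
    simp only [h, Finset.sum_ite_eq]
    split_ifs
    · exact le_rfl
    · positivity
  · refine (Finset.sum_eq_zero fun ν _ => if_neg ?_).le
    rintro ⟨i, hi, -⟩
    exact hp (Part.dom_iff_mem.2 ⟨i, hi⟩)

open Classical in
theorem summable_ite_mem (hU : IsPrefixMachine U) (ν : Env) :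
    Summable fun p => if ∃ i ∈ U p, E i = ν then (1 / 2 : ℝ) ^ p.length else 0 := by
  refine hU.summable.of_nonneg_of_le (fun p => ?_) fun p => ?_
  · split_ifs <;> positivity
  · simpa using ite_mem_le_ite_dom E U {ν} p

theorem priorWeight_nonneg (ν : Env) : 0 ≤ priorWeight E U ν :=
  tsum_nonneg fun p => by split_ifs <;> positivity

theorem sum_priorWeight_le_one (hU : IsPrefixMachine U) (S : Finset Env) :
    ∑ ν ∈ S, priorWeight E U ν ≤ 1 := by
  classical
  unfold priorWeight
  rw [← Summable.tsum_finsetSum fun ν _ => summable_ite_mem hU ν]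
  refine (Summable.tsum_le_tsum (ite_mem_le_ite_dom E U S)
    (summable_sum fun ν _ => summable_ite_mem hU ν) hU.summable).trans ?_
  exact Real.tsum_le_of_sum_le (fun p => by dsimp only; split_ifs <;> positivity) hU.sum_le_one

theorem summable_priorWeight (hU : IsPrefixMachine U) : Summable (priorWeight E U) :=
  summable_of_sum_le priorWeight_nonneg (sum_priorWeight_le_one hU)

theorem Env.nonneg (ν : Env) (h : History) : 0 ≤ ν.1 h := (ν.2.semimeasure.mem_Icc h).1

theorem priorWeight_mul_le (ν : Env) (h : History) :
    priorWeight E U ν * ν.1 h ≤ priorWeight E U ν :=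
  mul_le_of_le_one_right (priorWeight_nonneg ν) (ν.2.semimeasure.mem_Icc h).2

theorem summable_priorWeight_mul (hU : IsPrefixMachine U) (h : History) :
    Summable fun ν : Env => priorWeight E U ν * ν.1 h :=
  (summable_priorWeight hU).of_nonneg_of_le
    (fun ν => mul_nonneg (priorWeight_nonneg ν) (ν.nonneg h)) fun ν => priorWeight_mul_le ν h

theorem mixture_isChronologicalSemimeasure (hU : IsPrefixMachine U) :
    IsChronologicalSemimeasure (mixture E U) where
  mem_Icc h := by
    refine ⟨tsum_nonneg fun ν => mul_nonneg (priorWeight_nonneg ν) (ν.nonneg h), ?_⟩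
    refine (Summable.tsum_le_tsum (fun ν => priorWeight_mul_le ν h)
      (summable_priorWeight_mul hU h) (summable_priorWeight hU)).trans ?_
    exact Real.tsum_le_of_sum_le priorWeight_nonneg (sum_priorWeight_le_one hU)
  sum_le h a := by
    unfold mixture
    rw [← Summable.tsum_finsetSum fun e _ => summable_priorWeight_mul hU _]
    refine Summable.tsum_le_tsum (fun ν => ?_)
      (summable_sum fun e _ => summable_priorWeight_mul hU _) (summable_priorWeight_mul hU h)
    rw [← Finset.mul_sum]
    exact mul_le_mul_of_nonneg_left (ν.2.semimeasure.sum_le h a) (priorWeight_nonneg ν)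

/-! ### Reweighting a universal machine -/

/-- The machine that outputs `i` on the program `1` and runs `U` on `q` if fed with `000q`. -/
def reweight (i : ℕ) (U : List Bool →. ℕ) (p : List Bool) : Part ℕ :=
  bif decide (p = [true]) then Part.some i
  else bif decide (p.take 3 = [false, false, false]) then U (p.drop 3) else Part.none

theorem reweight_one (i : ℕ) (U : List Bool →. ℕ) : reweight i U [true] = Part.some i := rfl

theorem reweight_append (i : ℕ) (U : List Bool →. ℕ) (q : List Bool) :
    reweight i U ([false, false, false] ++ q) = U q := by
  simp [reweight]

theorem reweight_eq_none {i : ℕ} {U : List Bool →. ℕ} {p : List Bool} (h1 : p ≠ [true])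
    (h2 : p ∉ Set.range fun q => [false, false, false] ++ q) : reweight i U p = Part.none := by
  have h3 : p.take 3 ≠ [false, false, false] := fun h =>
    h2 ⟨p.drop 3, by simp only [← h, List.take_append_drop]⟩
  simp [reweight, h1, h3]

theorem reweight_dom_iff {i : ℕ} {U : List Bool →. ℕ} {p : List Bool} :
    (reweight i U p).Dom ↔ p = [true] ∨ ∃ q, [false, false, false] ++ q = p ∧ (U q).Dom := by
  constructor
  · intro h
    by_cases h1 : p = [true]
    · exact Or.inl h1
    by_cases h2 : p ∈ Set.range fun q => [false, false, false] ++ q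
    · obtain ⟨q, rfl⟩ := h2
      exact Or.inr ⟨q, rfl, by rwa [reweight_append] at h⟩
    · rw [reweight_eq_none h1 h2] at h
      exact h.elim
  · rintro (rfl | ⟨q, rfl, hq⟩)
    · trivial
    · rwa [reweight_append]

theorem IsUniversalMachine.reweight (hU : IsUniversalMachine U) (i : ℕ) :
    IsUniversalMachine (reweight i U) where
  isPrefixMachine :=
    { partrec := by
        refine Partrec.cond ?_ (Computable.const i).partrec (Partrec.cond ?_ ?_ Partrec.none)
        · exact (Primrec.eq.comp Primrec.id (Primrec.const _)).decide.to_comp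
        · exact (Primrec.eq.comp (Primrec.list_take.comp (Primrec.const 3) Primrec.id)
            (Primrec.const _)).decide.to_comp
        · exact hU.isPrefixMachine.partrec.comp
            (Primrec.list_drop.comp (Primrec.const 3) Primrec.id).to_comp
      prefixFree := by
        intro p q hp hq hpq
        rcases reweight_dom_iff.1 hp with rfl | ⟨p, rfl, hp⟩ <;>
          rcases reweight_dom_iff.1 hq with rfl | ⟨q, rfl, hq⟩
        · rfl
        · simp at hpq
        · simp at hpq
        · rw [hU.isPrefixMachine.prefixFree p q hp hq ((List.prefix_append_right_inj _).1 hpq)] }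
  universal := by
    intro T hT
    obtain ⟨s, hs⟩ := hU.universal T hT
    exact ⟨[false, false, false] ++ s, fun p => by rw [List.append_assoc, reweight_append, hs]⟩

open Classical in
theorem priorWeight_reweight (hU : IsPrefixMachine U) (i : ℕ) (ν : Env) :
    priorWeight E (reweight i U) ν =
      (if ν = E i then 1 / 2 else 0) + 1 / 8 * priorWeight E U ν := by
  set f : List Bool → ℝ := fun p =>
    if ∃ j ∈ reweight i U p, E j = ν then (1 / 2 : ℝ) ^ p.length else 0 with hf
  set g : List Bool → ℝ := fun p => if p = [true] then (if ν = E i then 1 / 2 else 0) else 0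
  set k : List Bool → ℝ := fun p => if p = [true] then 0 else f p with hk
  have hg : HasSum g (if ν = E i then 1 / 2 else 0) := hasSum_ite_eq _ _
  have hinj : Function.Injective fun q : List Bool => [false, false, false] ++ q :=
    fun p q h => List.append_cancel_left h
  -- Apart from `1`, only programs `000q` halt. Summing over `q` instead costs the factor `(1 / 2) ^
  -- 3`.
  have hk' : HasSum k (1 / 8 * priorWeight E U ν) := by
    rw [← hinj.hasSum_iff]
    · have heq : (k ∘ fun q : List Bool => [false, false, false] ++ q) = fun q =>
          1 / 8 * if ∃ j ∈ U q, E j = ν then (1 / 2 : ℝ) ^ q.length else 0 := by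
        funext q
        simp only [hk, hf, Function.comp_apply, reweight_append, mul_ite, mul_zero]
        rw [if_neg (by simp)]
        refine if_congr Iff.rfl ?_ rfl
        rw [List.length_append, pow_add]
        norm_num
      rw [heq]
      exact (summable_ite_mem hU ν).hasSum.mul_left (1 / 8)
    · intro p hp
      by_cases h1 : p = [true]
      · simp [hk, h1]
      · simp [hk, hf, h1, reweight_eq_none h1 hp]
  have hsum : f = fun p => g p + k p := by
    funext p
    by_cases h1 : p = [true]
    · subst h1
      simp [g, hk, hf, reweight_one, eq_comm]
    · simp [g, hk, h1]
  change ∑' p, f p = _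
  rw [hsum]
  exact (hg.add hk').tsum_eq

theorem mixture_reweight (hU : IsPrefixMachine U) (i : ℕ) (h : History) :
    mixture E (reweight i U) h = 1 / 2 * (E i).1 h + 1 / 8 * mixture E U h := by
  classical
  have h1 : HasSum (fun ν : Env => if ν = E i then 1 / 2 * (E i).1 h else 0)
    (1 / 2 * (E i).1 h) := hasSum_ite_eq _ _
  have h2 := (summable_priorWeight_mul (E := E) hU h).hasSum.mul_left (1 / 8)
  rw [mixture, ← (h1.add h2).tsum_eq]
  refine tsum_congr fun ν => ?_
  rw [priorWeight_reweight hU]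
  split_ifs with hν
  · rw [hν]; ring
  · ring

end AIXI

namespace AIXI

open Nat.Partrec (Code)

/-! ### Values for a horizon of one step -/

/-- The mass that is left after `n` further cycles in which the actions are chosen by `π`. -/
def pathMass (ρ : History → ℝ) (π : Policy) (h : History) (n : ℕ) : ℝ :=
  ∑ e : Fin n → Percept, ρ (extend π h (List.ofFn e))

theorem pathMass_zero (ρ : History → ℝ) (π : Policy) (h : History) : pathMass ρ π h 0 = ρ h := by
  simp [pathMass, extend]

theorem pathMass_succ (ρ : History → ℝ) (π : Policy) (h : History) (n : ℕ) :
    pathMass ρ π h (n + 1) = ∑ e : Percept, pathMass ρ π (h ++ [(π h, e)]) n := by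
  simp only [pathMass]
  rw [← (Fin.consEquiv fun _ : Fin (n + 1) => Percept).sum_comp, Fintype.sum_prod_type]
  simp [Fin.consEquiv, List.ofFn_succ, extend]

theorem pathMass_nonneg {ρ : History → ℝ} (hρ : ∀ h, 0 ≤ ρ h) (π : Policy) (h : History) (n : ℕ) :
    0 ≤ pathMass ρ π h n :=
  Finset.sum_nonneg fun _ _ => hρ _

theorem pathMass_antitone {ρ : History → ℝ} (hρ : IsChronologicalSemimeasure ρ) (π : Policy)
    (h : History) : Antitone (pathMass ρ π h) := by
  have key : ∀ n h, pathMass ρ π h (n + 1) ≤ pathMass ρ π h n := by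
    intro n
    induction n with
    | zero =>
      intro h
      rw [pathMass_succ]
      simpa only [pathMass_zero] using hρ.sum_le h (π h)
    | succ n ih =>
      intro h
      rw [pathMass_succ, pathMass_succ ρ π h n]
      exact Finset.sum_le_sum fun e _ => ih _
  exact antitone_nat_of_succ_le fun n => key n h

theorem discountNorm_lifetime (m : ℕ) : discountNorm (lifetime m) m = 1 := by
  rw [discountNorm, tsum_eq_single 0 fun i hi => by rw [lifetime, if_neg (by omega)]]
  simp [lifetime]

/-- The lifetime ends with the next cycle, so only the first reward counts. Later percepts still
matter, since a semimeasure may lose mass after the horizon. -/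
theorem rewardSum_lifetime_succ (ρ : History → ℝ) (π : Policy) (h : History) (n : ℕ) :
    rewardSum (lifetime (h.length + 1)) ρ π h (n + 1) =
      ∑ e : Percept, reward e * (pathMass ρ π (h ++ [(π h, e)]) n / ρ h) := by
  have hr : ∀ e : Fin (n + 1) → Percept,
      ∑ k : Fin (n + 1), lifetime (h.length + 1) (h.length + 1 + k) * reward (e k) =
        reward (e 0) := by
    intro e
    rw [Fin.sum_univ_succ]
    simp [lifetime]
  simp only [rewardSum, hr, pathMass, Finset.sum_div, Finset.mul_sum]
  rw [← (Fin.consEquiv fun _ : Fin (n + 1) => Percept).sum_comp, Fintype.sum_prod_type]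
  simp [Fin.consEquiv, List.ofFn_succ, extend]

theorem reward_nonneg (e : Percept) : 0 ≤ reward e := by
  unfold reward; split_ifs <;> norm_num

theorem rewardSum_lifetime_antitone {ρ : History → ℝ} (hρ : IsChronologicalSemimeasure ρ)
    (π : Policy) (h : History) :
    Antitone fun n => rewardSum (lifetime (h.length + 1)) ρ π h (n + 1) := by
  intro m n hmn
  simp only [rewardSum_lifetime_succ]
  exact Finset.sum_le_sum fun e _ => mul_le_mul_of_nonneg_left
    (div_le_div_of_nonneg_right (pathMass_antitone hρ π _ hmn) (hρ.mem_Icc h).1) (reward_nonneg e)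

theorem rewardSum_lifetime_nonneg {ρ : History → ℝ} (hρ : IsChronologicalSemimeasure ρ)
    (π : Policy) (h : History) (n : ℕ) :
    0 ≤ rewardSum (lifetime (h.length + 1)) ρ π h (n + 1) := by
  rw [rewardSum_lifetime_succ]
  exact Finset.sum_nonneg fun e _ => mul_nonneg (reward_nonneg e)
    (div_nonneg (pathMass_nonneg (fun h => (hρ.mem_Icc h).1) π _ n) (hρ.mem_Icc h).1)

theorem tendsto_rewardSum_lifetime {ρ : History → ℝ} (hρ : IsChronologicalSemimeasure ρ)
    (π : Policy) (h : History) :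
    Filter.Tendsto (fun n => rewardSum (lifetime (h.length + 1)) ρ π h (n + 1)) Filter.atTop
      (nhds (value (lifetime (h.length + 1)) ρ π h)) := by
  have h1 := tendsto_atTop_ciInf (rewardSum_lifetime_antitone hρ π h)
    ⟨0, by rintro _ ⟨n, rfl⟩; exact rewardSum_lifetime_nonneg hρ π h n⟩
  -- The shift skips `n = 0`, where the reward sum is empty and so breaks the monotonicity.
  have h2 := (Filter.tendsto_add_atTop_iff_nat 1).1 h1
  rw [value, discountNorm_lifetime, if_pos one_pos, div_one, one_mul, h2.limUnder_eq]
  exact h1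

theorem value_lifetime_le {ρ : History → ℝ} (hρ : IsChronologicalSemimeasure ρ)
    (π : Policy) (h : History) :
    value (lifetime (h.length + 1)) ρ π h ≤
      (ρ (h ++ [(π h, (true, true))]) + ρ (h ++ [(π h, (false, true))])) / ρ h := by
  have h1 := (rewardSum_lifetime_antitone hρ π h).le_of_tendsto
    (tendsto_rewardSum_lifetime hρ π h) 0
  refine h1.trans (le_of_eq ?_)
  rw [rewardSum_lifetime_succ]
  simp [pathMass_zero, Fintype.sum_prod_type, reward, add_div]

theorem le_value_lifetime {ρ : History → ℝ} (hρ : IsChronologicalSemimeasure ρ)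
    {π : Policy} {h : History} {b : ℝ}
    (hb : ∀ n, b ≤ pathMass ρ π (h ++ [(π h, (false, true))]) n) :
    b / ρ h ≤ value (lifetime (h.length + 1)) ρ π h := by
  refine ge_of_tendsto' (tendsto_rewardSum_lifetime hρ π h) fun n => ?_
  rw [rewardSum_lifetime_succ]
  have h1 : b / ρ h ≤ reward (false, true) *
      (pathMass ρ π (h ++ [(π h, (false, true))]) n / ρ h) := by
    simpa [reward] using div_le_div_of_nonneg_right (hb n) (hρ.mem_Icc h).1
  refine h1.trans (Finset.single_le_sum
    (f := fun e => reward e * (pathMass ρ π (h ++ [(π h, e)]) n / ρ h)) (fun e _ => ?_)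
    (Finset.mem_univ _))
  exact mul_nonneg (reward_nonneg e)
    (div_nonneg (pathMass_nonneg (fun h => (hρ.mem_Icc h).1) π _ n) (hρ.mem_Icc h).1)

theorem bddAbove_value_lifetime {ρ : History → ℝ} (hρ : IsChronologicalSemimeasure ρ)
    (h : History) : BddAbove (Set.range fun π => value (lifetime (h.length + 1)) ρ π h) := by
  refine ⟨2 / ρ h, ?_⟩
  rintro _ ⟨π, rfl⟩
  refine (value_lifetime_le hρ π h).trans (div_le_div_of_nonneg_right ?_ (hρ.mem_Icc h).1)
  linarith [(hρ.mem_Icc (h ++ [(π h, (true, true))])).2,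
    (hρ.mem_Icc (h ++ [(π h, (false, true))])).2]

theorem bddAbove_value_update {ρ : History → ℝ} (hρ : IsChronologicalSemimeasure ρ)
    (h : History) (a : Action) :
    BddAbove (Set.range fun π => value (lifetime (h.length + 1)) ρ (Function.update π h a) h) :=
  (bddAbove_value_lifetime hρ h).mono (by rintro _ ⟨π, rfl⟩; exact ⟨_, rfl⟩)

theorem value_le_optActionValue {ρ : History → ℝ} (hρ : IsChronologicalSemimeasure ρ)
    (π : Policy) (h : History) :
    value (lifetime (h.length + 1)) ρ π h ≤
      optActionValue (lifetime (h.length + 1)) ρ h (π h) := by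
  have h1 := le_ciSup (bddAbove_value_update hρ h (π h)) π
  simp only [Function.update_eq_self] at h1
  exact h1

/-! ### An environment that rewards deciding the halting problem -/

/-- The halting problem: `k` codes a program together with an input on which it halts. -/
def Halts (k : ℕ) : Prop := ((Denumerable.ofNat Code k.unpair.1).eval k.unpair.2).Dom

/-- A step of the state machine behind `haltingEnv`. In the control states `0` and `1` the
question is being posed and is about to be answered; the states `2` and `3` are reached by the
answers `false` and `true`; every other state has mass `0`. -/
def haltingStep (σ : ℕ × ℕ) (b : Action × Percept) : ℕ × ℕ :=
  if b.2.1 = true then (4, 0)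
  else if σ.1 = 0 then
    if b.2.2 = true then (4, 0) else if b.1 = true then (1, σ.2) else (0, σ.2 + 1)
  else if σ.1 = 1 then
    if b.1 = true then if b.2.2 = true then (3, σ.2) else (4, 0) else (2, σ.2)
  else if b.2.2 = true then (4, 0) else σ

open Classical in
/-- The mass of a control state. -/
noncomputable def haltingMass (σ : ℕ × ℕ) : ℝ :=
  if σ.1 ≤ 1 then 1 else if σ.1 = 2 then 1 / 2 else if σ.1 = 3 ∧ Halts σ.2 then 1 else 0

/-- The control state after a history. -/
def haltingState (h : History) : ℕ × ℕ := h.foldl haltingStep (0, 0)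

/-- The agent poses the question `k` by playing `false` exactly `k` times and then `true`. The answer
`false` is rewarded with probability `1 / 2`, the answer `true` if and only if `k` halts. -/
noncomputable def haltingEnv (h : History) : ℝ := haltingMass (haltingState h)

theorem haltingState_concat (h : History) (b : Action × Percept) :
    haltingState (h ++ [b]) = haltingStep (haltingState h) b := by
  simp [haltingState]

/-- Mass is preserved everywhere (the answer `false` splits it evenly between the two rewards),
except that the answer `true` destroys it if the program does not halt. -/
theorem haltingEnv_isChronologicalSemimeasure : IsChronologicalSemimeasure haltingEnv where
  mem_Icc h := by
    unfold haltingEnv haltingMass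
    split_ifs <;> norm_num
  sum_le h a := by
    simp only [haltingEnv, haltingState_concat]
    generalize haltingState h = σ
    obtain ⟨t, k⟩ := σ
    have h4 : haltingMass (4, 0) = 0 := by simp [haltingMass]
    rcases t with _ | _ | t
    · cases a <;> simp [haltingStep, Fintype.sum_prod_type, h4] <;> simp [haltingMass]
    · cases a
      · simp [haltingStep, Fintype.sum_prod_type, h4]
        simp [haltingMass]; norm_num
      · simp [haltingStep, Fintype.sum_prod_type, h4]
        simp [haltingMass]
        split_ifs <;> norm_num
    · simp [haltingStep, Fintype.sum_prod_type, h4]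

theorem primrec_haltingState : Primrec haltingState := by
  refine Primrec.list_foldl (α := History) (h := fun _ x => haltingStep x.1 x.2) Primrec.id
    (Primrec.const (0, 0)) (Primrec₂.mk ?_)
  have hσ : Primrec fun x : History × ((ℕ × ℕ) × (Action × Percept)) => x.2.1 :=
    Primrec.fst.comp Primrec.snd
  have hb : Primrec fun x : History × ((ℕ × ℕ) × (Action × Percept)) => x.2.2 :=
    Primrec.snd.comp Primrec.snd
  have ho := Primrec.eq.comp (Primrec.fst.comp (Primrec.snd.comp hb)) (Primrec.const true)
  have hr := Primrec.eq.comp (Primrec.snd.comp (Primrec.snd.comp hb)) (Primrec.const true)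
  have ha := Primrec.eq.comp (Primrec.fst.comp hb) (Primrec.const true)
  have hk := Primrec.snd.comp hσ
  have hd := Primrec.const (α := History × ((ℕ × ℕ) × (Action × Percept))) ((4, 0) : ℕ × ℕ)
  refine Primrec.ite ho hd (Primrec.ite (Primrec.eq.comp (Primrec.fst.comp hσ) (Primrec.const 0))
    (Primrec.ite hr hd (Primrec.ite ha ((Primrec.const 1).pair hk)
      ((Primrec.const 0).pair (Primrec.succ.comp hk))))
    (Primrec.ite (Primrec.eq.comp (Primrec.fst.comp hσ) (Primrec.const 1))
      (Primrec.ite ha (Primrec.ite hr ((Primrec.const 3).pair hk) hd) ((Primrec.const 2).pair hk))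
      (Primrec.ite hr hd hσ)))

theorem halts_iff {k : ℕ} : Halts k ↔
    ∃ s, (Code.evaln s (Denumerable.ofNat Code k.unpair.1) k.unpair.2).isSome :=
  Code.eval_dom_iff

theorem lt_haltingMass_iff {σ : ℕ × ℕ} {z : ℤ} {d : ℕ} :
    (z : ℝ) / ((d : ℝ) + 1) < haltingMass σ ↔ ∃ s : ℕ, z < 0 ∨
      (z.toNat < d + 1 ∧ (σ.1 ≤ 1 ∨ (σ.1 = 2 ∧ 2 * z.toNat < d + 1) ∨
        (σ.1 = 3 ∧
          (Code.evaln s (Denumerable.ofNat Code σ.2.unpair.1) σ.2.unpair.2).isSome))) := by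
  rw [div_lt_iff₀ (by positivity)]
  rcases lt_or_ge z 0 with hz | hz
  · have h0 : (0 : ℝ) ≤ haltingMass σ := by
      unfold haltingMass; split_ifs <;> norm_num
    have hz' : (z : ℝ) < 0 := by exact_mod_cast hz
    simp only [hz, true_or, exists_const, iff_true]
    exact hz'.trans_le (by positivity)
  · obtain ⟨k, rfl⟩ := Int.eq_ofNat_of_zero_le hz
    simp only [hz.not_gt, false_or, Int.toNat_natCast, Int.cast_natCast, exists_and_left,
      exists_or, exists_const, ← halts_iff]
    unfold haltingMass
    have h1 : (k : ℝ) < 1 * ((d : ℝ) + 1) ↔ k < d + 1 := by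
      rw [one_mul]; exact_mod_cast Iff.rfl
    have h2 : (k : ℝ) < 1 / 2 * ((d : ℝ) + 1) ↔ 2 * k < d + 1 := by
      rw [← @Nat.cast_lt ℝ]
      push_cast
      constructor <;> intro h <;> linarith
    have h3 : ¬ (k : ℝ) < 0 * ((d : ℝ) + 1) := by
      rw [zero_mul]; exact (Nat.cast_nonneg k).not_gt
    split_ifs with c1 c2 c3
    · rw [h1]; tauto
    · rw [h2]; omega
    · rw [h1]; tauto
    · simp only [h3, false_iff]; tauto

theorem haltingEnv_lowerSemicomputable : LowerSemicomputable haltingEnv := by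
  have hR : PrimrecPred fun y : (History × (ℤ × ℕ)) × ℕ => y.1.2.1 < 0 ∨
      (y.1.2.1.toNat < y.1.2.2 + 1 ∧ ((haltingState y.1.1).1 ≤ 1 ∨
        ((haltingState y.1.1).1 = 2 ∧ 2 * y.1.2.1.toNat < y.1.2.2 + 1) ∨
        ((haltingState y.1.1).1 = 3 ∧
          (Code.evaln y.2 (Denumerable.ofNat Code (haltingState y.1.1).2.unpair.1)
            (haltingState y.1.1).2.unpair.2).isSome))) := by
    have hσ : Primrec fun y : (History × (ℤ × ℕ)) × ℕ => haltingState y.1.1 :=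
      primrec_haltingState.comp (Primrec.fst.comp Primrec.fst)
    have ht := Primrec.fst.comp hσ
    have hu := Primrec.unpair.comp (Primrec.snd.comp hσ)
    have hz : Primrec fun y : (History × (ℤ × ℕ)) × ℕ => y.1.2.1 :=
      Primrec.fst.comp (Primrec.snd.comp Primrec.fst)
    have hk := Primrec.int_toNat.comp hz
    have hd : Primrec fun y : (History × (ℤ × ℕ)) × ℕ => y.1.2.2 + 1 :=
      Primrec.succ.comp (Primrec.snd.comp (Primrec.snd.comp Primrec.fst))
    exact (PrimrecPred.int_neg.comp hz).or ((Primrec.nat_lt.comp hk hd).and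
      ((Primrec.nat_le.comp ht (Primrec.const 1)).or
        (((Primrec.eq.comp ht (Primrec.const 2)).and
          (Primrec.nat_lt.comp (Primrec.nat_double.comp hk) hd)).or
        ((Primrec.eq.comp ht (Primrec.const 3)).and
          (primrecPred_evaln Primrec.snd ((Primrec.ofNat Code).comp (Primrec.fst.comp hu))
            (Primrec.snd.comp hu))))))
  exact (REPred.exists_nat hR.computablePred).of_eq fun x => lt_haltingMass_iff.symm

theorem haltingEnv_isLSCCCS : IsLSCCCS haltingEnv :=
  ⟨haltingEnv_isChronologicalSemimeasure, haltingEnv_lowerSemicomputable⟩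

/-- The history in which the question `k` is posed. -/
def question (k : ℕ) : History :=
  (List.range k).map (fun _ => (false, (false, false))) ++ [(true, (false, false))]

theorem length_question (k : ℕ) : (question k).length = k + 1 := by simp [question]

theorem primrec_question : Primrec question :=
  Primrec.list_append.comp (Primrec.list_map Primrec.list_range (Primrec₂.const _))
    (Primrec.const _)

theorem haltingState_question (k : ℕ) : haltingState (question k) = (1, k) := by
  have h : ∀ k, haltingState ((List.range k).map fun _ => (false, (false, false))) = (0, k) := by
    intro k
    induction k with
    | zero => rfl
    | succ k ih =>
      rw [List.range_succ, List.map_append, List.map_singleton, haltingState_concat, ih]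
      rfl
  rw [question, haltingState_concat, h]
  rfl

/-- After the answer, the percept `(false, false)` keeps the state under any action. So the reward
earned is not eroded in the limit defining the value. -/
theorem haltingEnv_le_pathMass (π : Policy) {h : History} (hh : 2 ≤ (haltingState h).1) (n : ℕ) :
    haltingEnv h ≤ pathMass haltingEnv π h n := by
  induction n generalizing h with
  | zero => rw [pathMass_zero]
  | succ n ih =>
    have hst : haltingState (h ++ [(π h, (false, false))]) = haltingState h := by
      rw [haltingState_concat, haltingStep]
      simp only [Bool.false_eq_true, if_false]
      rw [if_neg (by omega), if_neg (by omega)]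
    have h1 := ih (h := h ++ [(π h, (false, false))]) (by rw [hst]; exact hh)
    rw [haltingEnv, hst] at h1
    rw [pathMass_succ]
    exact h1.trans (Finset.single_le_sum
      (f := fun e => pathMass haltingEnv π (h ++ [(π h, e)]) n)
      (fun e _ => pathMass_nonneg (fun h => (haltingEnv_isChronologicalSemimeasure.mem_Icc h).1)
        π _ n) (Finset.mem_univ _))

/-- The probability that the answer `a` to the question `k` is rewarded. -/
noncomputable def answerMass (k : ℕ) (a : Action) : ℝ :=
  haltingEnv (question k ++ [(a, (false, true))])

open Classical in
theorem answerMass_eq (k : ℕ) (a : Action) :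
    answerMass k a = if a = true then (if Halts k then 1 else 0) else 1 / 2 := by
  rw [answerMass, haltingEnv, haltingState_concat, haltingState_question]
  cases a <;> simp [haltingStep, haltingMass]

/-! ### Optimal actions decide the halting problem -/

variable {ξ ζ : History → ℝ}

theorem half_answerMass_le_value (hξ : IsChronologicalSemimeasure ξ)
    (hζ : IsChronologicalSemimeasure ζ) (h : ∀ h, ξ h = 1 / 2 * haltingEnv h + 1 / 8 * ζ h)
    (k : ℕ) (π : Policy) :
    (1 / 2 * answerMass k (π (question k))) / ξ (question k) ≤
      value (lifetime ((question k).length + 1)) ξ π (question k) := by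
  refine le_value_lifetime hξ fun n => ?_
  have h1 : 2 ≤ (haltingState (question k ++ [(π (question k), (false, true))])).1 := by
    rw [haltingState_concat, haltingState_question]
    cases π (question k) <;> simp [haltingStep]
  have h2 := haltingEnv_le_pathMass π h1 n
  have h3 : ∀ g, 1 / 2 * pathMass haltingEnv π g n ≤ pathMass ξ π g n := by
    intro g
    rw [pathMass, pathMass, Finset.mul_sum]
    refine Finset.sum_le_sum fun e _ => ?_
    rw [h]
    linarith [(hζ.mem_Icc (extend π g (List.ofFn e))).1]
  refine le_trans ?_ (h3 _)
  exact mul_le_mul_of_nonneg_left h2 (by norm_num)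

theorem value_le_half_answerMass (hξ : IsChronologicalSemimeasure ξ)
    (hζ : IsChronologicalSemimeasure ζ) (h : ∀ h, ξ h = 1 / 2 * haltingEnv h + 1 / 8 * ζ h)
    (k : ℕ) (π : Policy) :
    value (lifetime ((question k).length + 1)) ξ π (question k) ≤
      (1 / 2 * answerMass k (π (question k)) + 1 / 8) / ξ (question k) := by
  refine (value_lifetime_le hξ π _).trans
    (div_le_div_of_nonneg_right ?_ (hξ.mem_Icc _).1)
  have h1 : haltingEnv (question k ++ [(π (question k), (true, true))]) = 0 := by
    rw [haltingEnv, haltingState_concat]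
    simp [haltingStep, haltingMass]
  -- Together the two rewarded percepts have `ζ`-mass at most 1, so `ζ` adds at most 1/8.
  have h2 := (hζ.sum_le (question k) (π (question k))).trans (hζ.mem_Icc _).2
  simp only [Fintype.sum_prod_type, Fintype.sum_bool] at h2
  rw [h, h, h1, answerMass]
  linarith [(hζ.mem_Icc (question k ++ [(π (question k), (true, false))])).1,
    (hζ.mem_Icc (question k ++ [(π (question k), (false, false))])).1]

theorem not_optimal_of_answerMass_add_half_le (hξ : IsChronologicalSemimeasure ξ)
    (hζ : IsChronologicalSemimeasure ζ) (h : ∀ h, ξ h = 1 / 2 * haltingEnv h + 1 / 8 * ζ h)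
    {k : ℕ} {a b : Action} (hab : answerMass k a + 1 / 2 ≤ answerMass k b) :
    1 / 9 ≤ optValue (lifetime ((question k).length + 1)) ξ (question k) -
      optActionValue (lifetime ((question k).length + 1)) ξ (question k) a := by
  have hm : haltingEnv (question k) = 1 := by
    simp [haltingEnv, haltingState_question, haltingMass]
  have hpos : 0 < ξ (question k) := by
    rw [h, hm]; linarith [(hζ.mem_Icc (question k)).1]
  have hle : ξ (question k) ≤ 5 / 8 := by
    rw [h, hm]; linarith [(hζ.mem_Icc (question k)).2]
  have h1 : (1 / 2 * answerMass k b) / ξ (question k) ≤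
      optValue (lifetime ((question k).length + 1)) ξ (question k) :=
    (half_answerMass_le_value hξ hζ h k fun _ => b).trans
      (le_ciSup (bddAbove_value_lifetime hξ _) _)
  have h2 : optActionValue (lifetime ((question k).length + 1)) ξ (question k) a ≤
      (1 / 2 * answerMass k a + 1 / 8) / ξ (question k) := by
    refine ciSup_le fun π => ?_
    simpa using value_le_half_answerMass hξ hζ h k (Function.update π (question k) a)
  -- The numerators differ by at least 1/4 − 1/8 = 1/8, and `ξ (question k) ≤ 5 / 8`.
  have h3 : 1 / 9 ≤ (1 / 2 * answerMass k b) / ξ (question k) -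
      (1 / 2 * answerMass k a + 1 / 8) / ξ (question k) := by
    rw [← sub_div, le_div_iff₀ hpos]
    linarith
  linarith

theorem eq_true_iff_halts (hξ : IsChronologicalSemimeasure ξ)
    (hζ : IsChronologicalSemimeasure ζ) (h : ∀ h, ξ h = 1 / 2 * haltingEnv h + 1 / 8 * ζ h)
    {k : ℕ} {a : Action}
    (ha : optValue (lifetime ((question k).length + 1)) ξ (question k) -
      optActionValue (lifetime ((question k).length + 1)) ξ (question k) a < 1 / 9) :
    a = true ↔ Halts k := by
  have key : ∀ b, ¬ answerMass k a + 1 / 2 ≤ answerMass k b := fun b hb =>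
    (not_optimal_of_answerMass_add_half_le hξ hζ h hb).not_gt ha
  by_cases hk : Halts k <;> cases a
  -- A wrong answer always trails by exactly 1/2: here 1/2 against 1, and 0 against 1/2 when `k`
  -- does not halt.
  · refine absurd ?_ (key true)
    simp only [answerMass_eq, hk]
    norm_num
  · simp [hk]
  · simp [hk]
  · refine absurd ?_ (key false)
    simp only [answerMass_eq, hk]
    norm_num

/-- A question has `k + 1` cycles, so its answer falls in cycle `k + 2`, the last of the lifetime.
Membership of `n` in the domain of `c` is the question `Nat.pair (encode c) n`. -/
theorem isSigma01Hard_policySet {π : ℕ → Policy}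
    (hπ : ∀ k, π (k + 2) (question k) = true ↔ Halts k) : IsSigma01Hard (policySet π) := by
  intro B hB
  obtain ⟨c, hc⟩ := REPred.exists_code hB
  have hk : Primrec fun n : ℕ => Nat.pair (Encodable.encode c) n :=
    Primrec₂.natPair.comp (Primrec.const _) Primrec.id
  refine ⟨fun n => Encodable.encode (Nat.pair (Encodable.encode c) n + 2,
    question (Nat.pair (Encodable.encode c) n), true), ?_, fun n => ?_⟩
  · exact (Primrec.encode.comp ((Primrec.succ.comp (Primrec.succ.comp hk)).pair
      ((primrec_question.comp hk).pair (Primrec.const true)))).to_comp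
  · have h1 : n ∈ B ↔ Halts (Nat.pair (Encodable.encode c) n) := by
      rw [Halts, ← hc n]
      simp
    change n ∈ B ↔ _
    rw [h1, ← hπ]
    constructor
    · intro h
      exact ⟨_, _, _, h, rfl⟩
    · rintro ⟨m, h, a, ha, heq⟩
      obtain ⟨rfl, rfl, rfl⟩ : _ ∧ _ ∧ _ := by
        simpa only [Prod.mk.injEq] using Encodable.encode_injective heq
      exact ha

theorem TakesEpsOptimalActions.isSigma01Hard (hξ : IsChronologicalSemimeasure ξ)
    (hζ : IsChronologicalSemimeasure ζ) (h : ∀ h, ξ h = 1 / 2 * haltingEnv h + 1 / 8 * ζ h)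
    {π : ℕ → Policy} (hπ : ∀ m, TakesEpsOptimalActions (lifetime m) ξ (1 / 9) (π m)) :
    IsSigma01Hard (policySet π) :=
  isSigma01Hard_policySet fun k => eq_true_iff_halts hξ hζ h
    (by simpa only [length_question] using hπ (k + 2) (question k))

/-- The value of a policy is at most the optimal value of the action it takes, so an ε-optimal
policy takes ε-optimal actions. -/
theorem IsEpsOptimal.isSigma01Hard (hξ : IsChronologicalSemimeasure ξ)
    (hζ : IsChronologicalSemimeasure ζ) (h : ∀ h, ξ h = 1 / 2 * haltingEnv h + 1 / 8 * ζ h)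
    {π : ℕ → Policy} (hπ : ∀ m, IsEpsOptimal (lifetime m) ξ (1 / 9) (π m)) :
    IsSigma01Hard (policySet π) := by
  refine isSigma01Hard_policySet fun k => eq_true_iff_halts hξ hζ h ?_
  have h1 := hπ (k + 2) (question k)
  have h2 := value_le_optActionValue hξ (π (k + 2)) (question k)
  simp only [length_question] at h2 ⊢
  linarith

end AIXI

/-! ### The main theorem -/

theorem mainTheorem6 :
    (∃ E : ℕ → AIXI.Env, AIXI.IsEffectiveEnumeration E) ∧
    (∃ U : List Bool →. ℕ, AIXI.IsUniversalMachine U) ∧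
    ∀ E : ℕ → AIXI.Env, AIXI.IsEffectiveEnumeration E →
    ∀ U : List Bool →. ℕ, AIXI.IsUniversalMachine U →
      ∃ (ν : AIXI.Env) (U' : List Bool →. ℕ), AIXI.IsUniversalMachine U' ∧
        (∀ h : AIXI.History,
          AIXI.mixture E U' h = 1 / 2 * ν.1 h + 1 / 8 * AIXI.mixture E U h) ∧
        (∀ π : ℕ → AIXI.Policy,
          (∀ m : ℕ, AIXI.IsEpsOptimal (AIXI.lifetime m) (AIXI.mixture E U') (1 / 9) (π m)) →
          AIXI.IsSigma01Hard (AIXI.policySet π)) ∧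
        (∀ π : ℕ → AIXI.Policy,
          (∀ m : ℕ,
            AIXI.TakesEpsOptimalActions (AIXI.lifetime m) (AIXI.mixture E U') (1 / 9) (π m)) →
          AIXI.IsSigma01Hard (AIXI.policySet π)) := by
  refine ⟨AIXI.exists_isEffectiveEnumeration, ⟨_, AIXI.universalMachine_isUniversal⟩, ?_⟩
  intro E hE U hU
  obtain ⟨i, hi⟩ := hE.surjective ⟨AIXI.haltingEnv, AIXI.haltingEnv_isLSCCCS⟩
  have hU' := hU.reweight i
  have hmix := AIXI.mixture_reweight (E := E) hU.isPrefixMachine i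
  rw [hi] at hmix
  have hξ := AIXI.mixture_isChronologicalSemimeasure (E := E) hU'.isPrefixMachine
  have hζ := AIXI.mixture_isChronologicalSemimeasure (E := E) hU.isPrefixMachine
  exact ⟨_, _, hU', hmix, fun _ => AIXI.IsEpsOptimal.isSigma01Hard hξ hζ hmix,
    fun _ => AIXI.TakesEpsOptimalActions.isSigma01Hard hξ hζ hmix⟩
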